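/- Let $\mathbf\Omega$ be the dendroidal category: its objects are finite rooted (non-planar) trees, forming a small set that contains every such tree up to isomorphism, and a morphism $S\to T$ is a morphism of the coloured symmetric operads $\Omega(S)\to\Omega(T)$. Here $\Omega(T)$ has the edges of $T$ as objects and exactly one operation $(e_1,\dots,e_n)\to e$ if $e_1,\dots,e_n$ lists without repetition the leaves of a subtree of $T$ with root $e$, and none otherwise. The edges of $T$ are partially ordered by: $e\le f$ if the path from $e$ to the root $r_T$ contains $f$. Let $\mathbf{dSets}$ be the category of presheaves of sets on $\mathbf\Omega$, and let $\mathcal N_d(P)=\mathsf{Op}(\Omega(-),P)$ be the dendroidal nerve of an operad $P$ in sets. For a dendroidal set $X$, let the operad of elements $\mathbf\Omega/X$ be the following operad. Its objects are the pairs $(T,\alpha)$ with $T$ a tree and $\alpha\in X_T$. An operation $(S_1,\alpha_1),\dots,(S_n,\alpha_n)\to(R,\beta)$ is a family of morphisms of trees $f_i\colon S_i\to R$ with $\beta\circ f_i=\alpha_i$ for all $i$ that is - independent: for $i\ne j$ and all edges $e$ of $S_i$ and $e'$ of $S_j$, the edges $f_i(e)$ and $f_j(e')$ of $R$ are incomparable;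 and - wide: $\Omega(R)(f_1(r_{S_1}),\dots,f_n(r_{S_n});r_R)\neq\emptyset$. Composition is composition of morphisms of trees. There are two conventions for $n=0$: either the empty family is not admitted at all, or it is admitted (it is then wide precisely when $R$ has no leaves). The statement below holds under each of them. A monomorphism $A\to B$ of dendroidal sets is normal if, for every tree $T$, the group $\mathrm{Aut}(T)$ acts freely on the complement of the image of $A_T$ in $B_T$. Then the endofunctor $X\mapsto\mathcal N_d(\mathbf\Omega/X)$ of $\mathbf{dSets}$ is cocontinuous (it preserves all small colimits); it is the left Kan extension, along the Yoneda embedding $\mathbf\Omega\to\mathbf{dSets}$, of its restriction to representables (with the identity as unit); and it sends normal monomorphisms to normal monomorphisms. -/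

import Mathlib

open CategoryTheory CategoryTheory.Limits Opposite

universe u v u' v' u'' v''

namespace Dendroidal

/-! ### Coloured symmetric operads in sets -/

/-- The reindexing of the inputs of `comp f (fun i => act (τ i) (g i))`. -/
def sumEquiv {n : ℕ} {m m' : Fin n → ℕ} (τ : ∀ i, Fin (m' i) ≃ Fin (m i)) :
    Fin (∑ i, m' i) ≃ Fin (∑ i, m i) :=
  finSigmaFinEquiv.symm.trans ((Equiv.sigmaCongrRight τ).trans finSigmaFinEquiv)

/-- The block permutation: the reindexing of the inputs of `comp (act σ f) (fun i => g (σ i))`. -/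
def blockEquiv {n n' : ℕ} (m : Fin n → ℕ) (σ : Fin n' ≃ Fin n) :
    Fin (∑ i, m (σ i)) ≃ Fin (∑ i, m i) :=
  finSigmaFinEquiv.symm.trans
    ((Equiv.sigmaCongrLeft (β := fun i => Fin (m i)) σ).trans finSigmaFinEquiv)

/-- The order preserving bijection between the inputs of `f ∘ (g ∘ h)` and of `(f ∘ g) ∘ h`. -/
def assocEquiv {n : ℕ} (m : Fin n → ℕ) (l : ∀ i, Fin (m i) → ℕ) :
    Fin (∑ p : Fin (∑ i, m i), l (finSigmaFinEquiv.symm p).1 (finSigmaFinEquiv.symm p).2) ≃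
      Fin (∑ i, ∑ j, l i j) :=
  finSigmaFinEquiv.symm.trans <|
    (Equiv.sigmaCongrLeft (β := fun q : (Σ i, Fin (m i)) => Fin (l q.1 q.2))
      finSigmaFinEquiv.symm).trans <|
    (Equiv.sigmaAssoc (fun i (j : Fin (m i)) => Fin (l i j))).trans <|
    (Equiv.sigmaCongrRight (fun _ => finSigmaFinEquiv)).trans finSigmaFinEquiv

/-- The identification of the inputs of `comp (one d) (fun _ => f)` with those of `f`. -/
def oneCompEquiv (m : ℕ) : Fin (∑ _i : Fin 1, m) ≃ Fin m :=
  finSigmaFinEquiv.symm.trans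
    { toFun := fun q => q.2
      invFun := fun x => ⟨0, x⟩
      left_inv := fun ⟨i, x⟩ => by rw [Subsingleton.elim i 0]
      right_inv := fun _ => rfl }

/-- The identification of the inputs of `comp f (fun i => one (c i))` with those of `f`. -/
def compOneEquiv (n : ℕ) : Fin (∑ _i : Fin n, 1) ≃ Fin n :=
  finSigmaFinEquiv.symm.trans (Equiv.sigmaUnique (Fin n) (fun _ => Fin 1))

theorem sumEquiv_spec {n : ℕ} {m m' : Fin n → ℕ} (τ : ∀ i, Fin (m' i) ≃ Fin (m i))
    (p : Fin (∑ i, m' i)) :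
    finSigmaFinEquiv.symm (sumEquiv τ p) =
      ⟨(finSigmaFinEquiv.symm p).1, τ _ (finSigmaFinEquiv.symm p).2⟩ :=
  finSigmaFinEquiv.symm_apply_apply _

theorem blockEquiv_spec {n n' : ℕ} (m : Fin n → ℕ) (σ : Fin n' ≃ Fin n)
    (p : Fin (∑ i, m (σ i))) :
    finSigmaFinEquiv.symm (blockEquiv m σ p) =
      ⟨σ (finSigmaFinEquiv.symm p).1, (finSigmaFinEquiv.symm p).2⟩ :=
  finSigmaFinEquiv.symm_apply_apply _

theorem assocEquiv_spec {n : ℕ} (m : Fin n → ℕ) (l : ∀ i, Fin (m i) → ℕ)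
    (p : Fin (∑ p : Fin (∑ i, m i),
      l (finSigmaFinEquiv.symm p).1 (finSigmaFinEquiv.symm p).2)) :
    (⟨(finSigmaFinEquiv.symm (assocEquiv m l p)).1,
      finSigmaFinEquiv.symm (finSigmaFinEquiv.symm (assocEquiv m l p)).2⟩ :
        Σ i, Σ j, Fin (l i j)) =
      ⟨(finSigmaFinEquiv.symm (finSigmaFinEquiv.symm p).1).1,
        (finSigmaFinEquiv.symm (finSigmaFinEquiv.symm p).1).2, (finSigmaFinEquiv.symm p).2⟩ :=
  (congrArg (fun s : (Σ i, Fin (∑ j, l i j)) =>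
      (⟨s.1, finSigmaFinEquiv.symm s.2⟩ : Σ i, Σ j, Fin (l i j)))
    (finSigmaFinEquiv.symm_apply_apply _)).trans
    (congrArg (Sigma.mk _) (finSigmaFinEquiv.symm_apply_apply _))

/-- A (discrete) operad: a coloured symmetric operad in sets. For `c = (c₁, …, cₙ)` the set of
operations `P(c₁, …, cₙ; d)` is `P.Op c d`. The action of the symmetric groups is `act`; it is
stated for bijections `Fin m ≃ Fin n` (so that `m = n`) and up to equality of colours, in order
to avoid casts. `comp` is the total composition `f ∘ (g₁, …, gₙ)`, whose inputs are those of
`g₁, …, gₙ` in lexicographic order. -/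
structure Operad where
  /-- the objects, or colours -/
  Ob : Type u
  /-- the operations -/
  Op : {n : ℕ} → (Fin n → Ob) → Ob → Type v
  /-- the identities -/
  one : (c : Ob) → Op (fun _ : Fin 1 => c) c
  /-- the action of the symmetric groups -/
  act : {m n : ℕ} → {c : Fin n → Ob} → {c' : Fin m → Ob} → {d : Ob} → (σ : Fin m ≃ Fin n) →
    (∀ i, c' i = c (σ i)) → Op c d → Op c' d
  /-- total composition -/
  comp : {n : ℕ} → {m : Fin n → ℕ} → {c : Fin n → Ob} → {d : Ob} →
    {b : ∀ i, Fin (m i) → Ob} → Op c d → (∀ i, Op (b i) (c i)) →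
    Op (fun p : Fin (∑ i, m i) => b (finSigmaFinEquiv.symm p).1 (finSigmaFinEquiv.symm p).2) d
  act_refl : ∀ {n : ℕ} {c : Fin n → Ob} {d : Ob} (f : Op c d),
    act (Equiv.refl _) (fun _ => rfl) f = f
  act_trans : ∀ {k m n : ℕ} {c : Fin n → Ob} {c' : Fin m → Ob} {c'' : Fin k → Ob} {d : Ob}
    (τ : Fin k ≃ Fin m) (σ : Fin m ≃ Fin n) (hτ : ∀ i, c'' i = c' (τ i))
    (hσ : ∀ i, c' i = c (σ i)) (f : Op c d),
    act τ hτ (act σ hσ f) = act (τ.trans σ) (fun i => (hτ i).trans (hσ (τ i))) f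
  one_comp : ∀ {m : ℕ} {c : Fin m → Ob} {d : Ob} (f : Op c d),
    comp (one d) (fun _ => f) = act (oneCompEquiv m) (fun _ => rfl) f
  comp_one : ∀ {n : ℕ} {c : Fin n → Ob} {d : Ob} (f : Op c d),
    comp f (fun i => one (c i)) = act (compOneEquiv n) (fun _ => rfl) f
  assoc : ∀ {n : ℕ} {m : Fin n → ℕ} {l : ∀ i, Fin (m i) → ℕ} {c : Fin n → Ob} {d : Ob}
    {b : ∀ i, Fin (m i) → Ob} {a : ∀ i j, Fin (l i j) → Ob}
    (f : Op c d) (g : ∀ i, Op (b i) (c i)) (h : ∀ i j, Op (a i j) (b i j)),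
    comp (comp f g) (fun p => h (finSigmaFinEquiv.symm p).1 (finSigmaFinEquiv.symm p).2) =
      act (assocEquiv m l) (fun p => congrArg (fun q : (Σ i, Σ j, Fin (l i j)) =>
          a q.1 q.2.1 q.2.2) (assocEquiv_spec m l p).symm)
        (comp f (fun i => comp (g i) (h i)))
  act_comp : ∀ {n n' : ℕ} {m : Fin n → ℕ} {c : Fin n → Ob} {d : Ob}
    {b : ∀ i, Fin (m i) → Ob} (σ : Fin n' ≃ Fin n) (f : Op c d) (g : ∀ i, Op (b i) (c i)),
    comp (act (c' := fun i => c (σ i)) σ (fun _ => rfl) f) (fun i => g (σ i)) =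
      act (blockEquiv m σ) (fun p => congrArg (fun q : (Σ i, Fin (m i)) => b q.1 q.2)
        (blockEquiv_spec m σ p).symm) (comp f g)
  comp_act : ∀ {n : ℕ} {m m' : Fin n → ℕ} {c : Fin n → Ob} {d : Ob}
    {b : ∀ i, Fin (m i) → Ob} (τ : ∀ i, Fin (m' i) ≃ Fin (m i)) (f : Op c d)
    (g : ∀ i, Op (b i) (c i)),
    comp f (fun i => act (c' := fun j => b i (τ i j)) (τ i) (fun _ => rfl) (g i)) =
      act (sumEquiv τ) (fun p => congrArg (fun q : (Σ i, Fin (m i)) => b q.1 q.2)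
        (sumEquiv_spec τ p).symm) (comp f g)

/-- Morphisms of operads. -/
@[ext]
structure Operad.Hom (P : Operad.{u, v}) (Q : Operad.{u', v'}) where
  /-- the map on objects -/
  ob : P.Ob → Q.Ob
  /-- the map on operations -/
  op : ∀ {n : ℕ} {c : Fin n → P.Ob} {d : P.Ob}, P.Op c d → Q.Op (fun i => ob (c i)) (ob d)
  map_one : ∀ c, op (P.one c) = Q.one (ob c)
  map_act : ∀ {m n : ℕ} {c : Fin n → P.Ob} {c' : Fin m → P.Ob} {d : P.Ob} (σ : Fin m ≃ Fin n)
    (h : ∀ i, c' i = c (σ i)) (f : P.Op c d),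
    op (P.act σ h f) = Q.act σ (fun i => congrArg ob (h i)) (op f)
  map_comp : ∀ {n : ℕ} {m : Fin n → ℕ} {c : Fin n → P.Ob} {d : P.Ob}
    {b : ∀ i, Fin (m i) → P.Ob} (f : P.Op c d) (g : ∀ i, P.Op (b i) (c i)),
    op (P.comp f g) = Q.comp (op f) (fun i => op (g i))

/-- The identity morphism of an operad. -/
def Operad.Hom.id (P : Operad.{u, v}) : Operad.Hom P P where
  ob c := c
  op f := f
  map_one _ := rfl
  map_act _ _ _ := rfl
  map_comp _ _ := rfl

/-- The composite `G ∘ F` of morphisms of operads. -/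
def Operad.Hom.comp {P : Operad.{u, v}} {Q : Operad.{u', v'}} {R : Operad.{u'', v''}}
    (F : Operad.Hom P Q) (G : Operad.Hom Q R) : Operad.Hom P R where
  ob c := G.ob (F.ob c)
  op f := G.op (F.op f)
  map_one c := by rw [F.map_one, G.map_one]
  map_act σ h f := by rw [F.map_act, G.map_act]
  map_comp f g := by rw [F.map_comp, G.map_comp]

/-- The category of operads. -/
instance : Category Operad.{u, v} where
  Hom P Q := Operad.Hom P Q
  id P := Operad.Hom.id P
  comp F G := Operad.Hom.comp F G

/-! ### Trees -/

/-- A finite rooted (non-planar) tree, encoded by its poset of edges, where `e ≤ f` means that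
the path from `e` to the root contains `f`, and by the set of those minimal edges which are
leaves. The vertices of the tree correspond to the edges which are not leaves (a vertex
corresponds to its output edge); the inputs of the vertex with output `e` are the edges covered
by `e`. The minimal edges that are not leaves are the output edges of the stumps. Taking
the set of edges to be some `Fin card` makes trees a small set, which still contains every
finite rooted tree up to isomorphism. -/
structure Tree where
  /-- the number of edges -/
  card : ℕ
  /-- the order on edges -/
  le : Fin card → Fin card → Prop
  le_refl : ∀ e, le e e
  le_trans : ∀ a b c, le a b → le b c → le a c
  le_antisymm : ∀ a b, le a b → le b a → a = b
  /-- the root -/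
  root : Fin card
  le_root : ∀ e, le e root
  /-- there is only one path from an edge to the root -/
  le_total_above : ∀ e a b, le e a → le e b → le a b ∨ le b a
  /-- the leaves -/
  leaves : Set (Fin card)
  leaves_minimal : ∀ l ∈ leaves, ∀ e, le e l → e = l

namespace Tree

/-- The set of edges of a tree. -/
def E (T : Tree) : Type := Fin T.card

instance (T : Tree) : Fintype T.E := inferInstanceAs (Fintype (Fin T.card))

instance (T : Tree) : PartialOrder T.E where
  le := T.le
  le_refl := T.le_refl
  le_trans := T.le_trans
  le_antisymm := T.le_antisymm

/-- The root edge. -/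
def r (T : Tree) : T.E := T.root

/-- The set of leaves. -/
def L (T : Tree) : Set T.E := T.leaves

/-- `T.IsSubtree A e`: there is a subtree of `T` with set of leaves `A` and root `e`. Such a
subtree is either the single edge `e`, or consists of the vertex with output `e` together with
a subtree grafted on each of its inputs. -/
inductive IsSubtree (T : Tree) : Set T.E → T.E → Prop
  | edge (e : T.E) : IsSubtree T {e} e
  | graft (e : T.E) (he : e ∉ T.L) (A : T.E → Set T.E)
      (hA : ∀ i, i ⋖ e → IsSubtree T (A i) i) : IsSubtree T {x | ∃ i, i ⋖ e ∧ x ∈ A i} e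

theorem IsSubtree.le {T : Tree} {A : Set T.E} {e : T.E} (h : T.IsSubtree A e) :
    ∀ x ∈ A, x ≤ e := by
  induction h with
  | edge e => rintro x rfl; exact le_rfl
  | graft e he A hA ih =>
    rintro x ⟨i, hi, hx⟩
    exact (ih i hi x hx).trans hi.le

theorem eq_of_covBy {T : Tree} {i j e z : T.E} (hi : i ⋖ e) (hj : j ⋖ e) (h : z ≤ i)
    (h' : z ≤ j) : i = j := by
  rcases T.le_total_above z i j h h' with hij | hij
  · exact eq_of_le_of_not_lt (α := T.E) hij fun hlt => hi.2 hlt hj.1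
  · exact (eq_of_le_of_not_lt (α := T.E) hij fun hlt => hj.2 hlt hi.1).symm

/-- Distinct leaves of a subtree are incomparable; indeed nothing lies below both. -/
theorem IsSubtree.eq_of_le {T : Tree} {A : Set T.E} {e : T.E} (h : T.IsSubtree A e) :
    ∀ x ∈ A, ∀ y ∈ A, ∀ z, z ≤ x → z ≤ y → x = y := by
  induction h with
  | edge e => rintro x rfl y rfl _ _ _; rfl
  | graft e he A hA ih =>
    rintro x ⟨i, hi, hx⟩ y ⟨j, hj, hy⟩ z hzx hzy
    obtain rfl := eq_of_covBy hi hj (hzx.trans ((hA i hi).le x hx))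
      (hzy.trans ((hA j hj).le y hy))
    exact ih i hi x hx y hy z hzx hzy

/-- Grafting of subtrees. -/
theorem IsSubtree.bind {T : Tree} {A : Set T.E} {e : T.E} (h : T.IsSubtree A e)
    (B : T.E → Set T.E) (hB : ∀ x ∈ A, T.IsSubtree (B x) x) :
    T.IsSubtree {y | ∃ x ∈ A, y ∈ B x} e := by
  induction h with
  | edge e =>
    have : {y | ∃ x ∈ ({e} : Set T.E), y ∈ B x} = B e := by ext y; simp
    rw [this]
    exact hB e rfl
  | graft e he A hA ih =>
    have : {y | ∃ x ∈ {x | ∃ i, i ⋖ e ∧ x ∈ A i}, y ∈ B x} =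
        {y | ∃ i, i ⋖ e ∧ y ∈ {y | ∃ x ∈ A i, y ∈ B x}} := by
      ext y
      constructor
      · rintro ⟨x, ⟨i, hi, hx⟩, hy⟩
        exact ⟨i, hi, x, hx, hy⟩
      · rintro ⟨i, hi, x, hx, hy⟩
        exact ⟨x, ⟨i, hi, hx⟩, hy⟩
    rw [this]
    exact IsSubtree.graft e he _ fun i hi => ih i hi fun x hx => hB x ⟨i, hi, hx⟩

/-- `e₁, …, eₙ` is a repetition-free list of the leaves of a subtree with root `e`. -/
def IsOp (T : Tree) {n : ℕ} (c : Fin n → T.E) (e : T.E) : Prop :=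
  Function.Injective c ∧ T.IsSubtree (Set.range c) e

theorem IsOp.one (T : Tree) (e : T.E) : T.IsOp (fun _ : Fin 1 => e) e :=
  ⟨fun _ _ _ => Subsingleton.elim _ _, by simpa using IsSubtree.edge e⟩

theorem IsOp.act {T : Tree} {m n : ℕ} {c : Fin n → T.E} {c' : Fin m → T.E} {e : T.E}
    (σ : Fin m ≃ Fin n) (h : ∀ i, c' i = c (σ i)) (hc : T.IsOp c e) : T.IsOp c' e := by
  obtain rfl : c' = c ∘ σ := funext h
  exact ⟨hc.1.comp σ.injective, by rw [EquivLike.range_comp]; exact hc.2⟩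

theorem IsOp.comp {T : Tree} {n : ℕ} {m : Fin n → ℕ} {c : Fin n → T.E} {d : T.E}
    {b : ∀ i, Fin (m i) → T.E} (hc : T.IsOp c d) (hb : ∀ i, T.IsOp (b i) (c i)) :
    T.IsOp (fun p : Fin (∑ i, m i) =>
      b (finSigmaFinEquiv.symm p).1 (finSigmaFinEquiv.symm p).2) d := by
  constructor
  · have key : Function.Injective (fun q : (Σ i, Fin (m i)) => b q.1 q.2) := by
      rintro ⟨i, j⟩ ⟨i', j'⟩ h
      simp only at h
      have h1 := (hb i).2.le _ ⟨j, rfl⟩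
      have h2 := (hb i').2.le _ ⟨j', rfl⟩
      rw [← h] at h2
      obtain rfl := hc.1 (hc.2.eq_of_le _ ⟨i, rfl⟩ _ ⟨i', rfl⟩ _ h1 h2)
      obtain rfl := (hb i).1 h
      rfl
    exact key.comp finSigmaFinEquiv.symm.injective
  · classical
    have := hc.2.bind (fun x => {y | ∃ i, c i = x ∧ y ∈ Set.range (b i)}) (by
      rintro _ ⟨i, rfl⟩
      have : {y | ∃ i', c i' = c i ∧ y ∈ Set.range (b i')} = Set.range (b i) := by
        ext y
        constructor
        · rintro ⟨i', hi', hy⟩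
          obtain rfl := hc.1 hi'
          exact hy
        · exact fun hy => ⟨i, rfl, hy⟩
      rw [this]
      exact (hb i).2)
    convert this using 1
    ext y
    constructor
    · rintro ⟨p, rfl⟩
      exact ⟨_, ⟨(finSigmaFinEquiv.symm p).1, rfl⟩, _, rfl, _, rfl⟩
    · rintro ⟨_, ⟨_, rfl⟩, i, _, j, rfl⟩
      exact ⟨finSigmaFinEquiv ⟨i, j⟩, congrArg (fun q : (Σ i, Fin (m i)) => b q.1 q.2)
        (finSigmaFinEquiv.symm_apply_apply _)⟩

/-- The operad `Ω(T)` of a tree: its objects are the edges of `T`, and there is exactly one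
operation `(e₁, …, eₙ) → e` if there is a subtree of `T` with leaves `e₁, …, eₙ` and root `e`,
and none otherwise. -/
def operad (T : Tree) : Operad.{0, 0} where
  Ob := T.E
  Op c e := PLift (T.IsOp c e)
  one e := ⟨IsOp.one T e⟩
  act σ h f := ⟨f.down.act σ h⟩
  comp f g := ⟨f.down.comp fun i => (g i).down⟩
  act_refl _ := rfl
  act_trans _ _ _ _ _ := rfl
  one_comp _ := rfl
  comp_one _ := rfl
  assoc _ _ _ := rfl
  act_comp _ _ _ := rfl
  comp_act _ _ _ := rfl

/-- The dendroidal category `Ω`: a morphism of trees is a morphism of the associated operads. -/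
instance : Category.{0} Tree where
  Hom S T := Operad.Hom S.operad T.operad
  id T := Operad.Hom.id T.operad
  comp f g := Operad.Hom.comp f g

/-- The map on edges of a morphism of trees. -/
def edge {S T : Tree} (f : S ⟶ T) : S.E → T.E := Operad.Hom.ob f

theorem edge_comp {S T R : Tree} (f : S ⟶ T) (g : T ⟶ R) (e : S.E) :
    edge (f ≫ g) e = edge g (edge f e) := rfl

theorem isOp_map {S T : Tree} (f : S ⟶ T) {n : ℕ} {c : Fin n → S.E} {e : S.E}
    (h : S.IsOp c e) : T.IsOp (fun i => edge f (c i)) (edge f e) :=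
  (Operad.Hom.op f (c := c) (d := e) (PLift.up h)).down

/-- A morphism of trees is monotone on edges. -/
theorem edge_mono {S T : Tree} (f : S ⟶ T) : Monotone (edge f) := by
  classical
  have key : ∀ x y : S.E, x ⋖ y → edge f x ≤ edge f y := by
    intro x y hxy
    have hy : y ∉ S.L := fun hy => hxy.1.ne (S.leaves_minimal y hy x hxy.1.le)
    let s : Finset S.E := Finset.univ.filter (· ⋖ y)
    let c : Fin s.card → S.E := fun i => (s.equivFin.symm i : S.E)
    have hr : Set.range c = {z | ∃ i, i ⋖ y ∧ z ∈ ({i} : Set S.E)} := by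
      ext z
      constructor
      · rintro ⟨i, rfl⟩
        exact ⟨_, (Finset.mem_filter.1 (s.equivFin.symm i).2).2, rfl⟩
      · rintro ⟨i, hi, rfl⟩
        exact ⟨s.equivFin ⟨z, Finset.mem_filter.2 ⟨Finset.mem_univ _, hi⟩⟩, by simp [c]⟩
    have hc : S.IsOp c y := ⟨Subtype.val_injective.comp s.equivFin.symm.injective, by
      rw [hr]; exact IsSubtree.graft y hy _ fun i _ => IsSubtree.edge i⟩
    obtain ⟨i, hi⟩ : x ∈ Set.range c := by rw [hr]; exact ⟨x, hxy, rfl⟩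
    have := (isOp_map f hc).2.le _ ⟨i, rfl⟩
    rw [← hi]
    exact this
  let : LocallyFiniteOrder S.E := Fintype.toLocallyFiniteOrder
  intro x y hxy
  induction le_iff_reflTransGen_covBy.1 hxy with
  | refl => exact le_rfl
  | tail h1 h2 ih => exact (ih (le_iff_reflTransGen_covBy.2 h1)).trans (key _ _ h2)

end Tree

/-! ### Dendroidal sets and the dendroidal nerve -/

/-- The category of dendroidal sets. -/
abbrev DSet := Treeᵒᵖ ⥤ Type u

/-- The dendroidal nerve of an operad: `T ↦ Op(Ω(T), P)`. -/
def nerveObj (P : Operad.{u, v}) : DSet.{max u v} where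
  obj T := Operad.Hom T.unop.operad P
  map f := ↾fun x => Operad.Hom.comp f.unop x

/-- The dendroidal nerve functor. -/
def nerve : Operad.{u, v} ⥤ DSet.{max u v} where
  obj := nerveObj
  map F := { app := fun _ => ↾fun x => Operad.Hom.comp x F }

/-- A monomorphism `f : X ⟶ Y` of dendroidal sets is normal if, for every tree `T`, the group
of automorphisms of `T` acts freely on the complement of the image of `X_T` in `Y_T`. -/
def IsNormalMono {X Y : DSet.{u}} (f : X ⟶ Y) : Prop :=
  Mono f ∧ ∀ (T : Tree) (y : Y.obj (op T)), y ∉ Set.range (f.app (op T)) →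
    ∀ σ : T ≅ T, Y.map σ.hom.op y = y → σ = Iso.refl T

/-! ### Wide independent maps and the operad of elements -/

/-- A map of forests `S₁ ⊕ … ⊕ Sₙ → R` to a tree, given by its components, is independent
if edges coming from different constituents have incomparable images. -/
def Independent {n : ℕ} {S : Fin n → Tree} {R : Tree} (f : ∀ i, S i ⟶ R) : Prop :=
  ∀ i j, i ≠ j → ∀ (e : (S i).E) (e' : (S j).E),
    ¬ Tree.edge (f i) e ≤ Tree.edge (f j) e' ∧ ¬ Tree.edge (f j) e' ≤ Tree.edge (f i) e

/-- A map of forests `S₁ ⊕ … ⊕ Sₙ → R` to a tree is wide if the set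
`Ω(R)(f(r₁), …, f(rₙ); r)` is non-empty, where `rᵢ` and `r` are the roots of `Sᵢ` and `R`. -/
def Wide {n : ℕ} {S : Fin n → Tree} {R : Tree} (f : ∀ i, S i ⟶ R) : Prop :=
  Nonempty (R.operad.Op (fun i => Tree.edge (f i) (S i).r) R.r)

/-- The elements of a dendroidal set `X`: pairs `(T, α)` of a tree `T` and `α ∈ X_T`, that is,
a map from the representable of `T` to `X`. -/
structure Element (X : DSet.{u}) : Type u where
  /-- the tree -/
  tree : Tree
  /-- the element -/
  elt : X.obj (op tree)

/-- The operations `(S₁, α₁), …, (Sₙ, αₙ) → (R, β)` of the operad of elements: the wide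
independent maps of forests `f : S₁ ⊕ … ⊕ Sₙ → R` such that `β ∘ f = (α₁, …, αₙ)`. If
`nullary` is false then the empty forest (`n = 0`) is not admitted; if `nullary` is true it is
(and the empty forest has a wide map to `R` exactly if `R` has no leaves). -/
@[ext]
structure ElementOp (nullary : Prop) {X : DSet.{u}} {n : ℕ} (c : Fin n → Element X)
    (d : Element X) : Type where
  /-- the components of the map of forests -/
  map : ∀ i, (c i).tree ⟶ d.tree
  nonempty : nullary ∨ n ≠ 0
  independent : Independent map
  wide : Wide map
  w : ∀ i, X.map (map i).op d.elt = (c i).elt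

namespace ElementOp

variable {N : Prop} {X : DSet.{u}}

/-- The identity operation. -/
def one (N : Prop) {X : DSet.{u}} (c : Element X) : ElementOp N (fun _ : Fin 1 => c) c where
  map _ := 𝟙 c.tree
  nonempty := Or.inr one_ne_zero
  independent i j h := (h (Subsingleton.elim i j)).elim
  wide := ⟨c.tree.operad.one c.tree.r⟩
  w _ := by simp

/-- The morphism of trees underlying an equality of elements. -/
def castHom {a b : Element X} (h : a = b) : a.tree ⟶ b.tree :=
  eqToHom (congrArg Element.tree h)

theorem castHom_w {a b : Element X} (h : a = b) : X.map (castHom h).op b.elt = a.elt := by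
  subst h; simp [castHom]

theorem castHom_r {a b : Element X} (h : a = b) :
    Tree.edge (castHom h) a.tree.r = b.tree.r := by
  subst h; rfl

@[simp]
theorem castHom_refl {a : Element X} (h : a = a) : castHom h = 𝟙 a.tree := rfl

/-- Permutation of the constituents of the source. -/
def act {m n : ℕ} {c : Fin n → Element X} {c' : Fin m → Element X} {d : Element X}
    (σ : Fin m ≃ Fin n) (h : ∀ i, c' i = c (σ i)) (f : ElementOp N c d) :
    ElementOp N c' d where
  map i := castHom (h i) ≫ f.map (σ i)
  nonempty := f.nonempty.imp_right fun hn hm => hn (by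
    subst hm; exact (Fin.equiv_iff_eq.1 ⟨σ⟩).symm)
  independent i j hij e e' := by
    simp only [Tree.edge_comp]
    exact f.independent _ _ (σ.injective.ne hij) _ _
  wide := by
    obtain ⟨x⟩ := f.wide
    exact ⟨d.tree.operad.act σ (fun i => by rw [Tree.edge_comp, castHom_r]) x⟩
  w i := by
    rw [op_comp, Functor.map_comp, comp_apply, f.w, castHom_w]

/-- Composition of operations. -/
def comp {n : ℕ} {m : Fin n → ℕ} {c : Fin n → Element X} {d : Element X}
    {b : ∀ i, Fin (m i) → Element X} (f : ElementOp N c d)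
    (g : ∀ i, ElementOp N (b i) (c i)) :
    ElementOp N (fun p : Fin (∑ i, m i) =>
      b (finSigmaFinEquiv.symm p).1 (finSigmaFinEquiv.symm p).2) d where
  map p := (g (finSigmaFinEquiv.symm p).1).map (finSigmaFinEquiv.symm p).2 ≫
    f.map (finSigmaFinEquiv.symm p).1
  nonempty := by
    by_cases hN : N
    · exact Or.inl hN
    · refine Or.inr fun h => ?_
      have hn : n ≠ 0 := f.nonempty.resolve_left hN
      have i : Fin n := ⟨0, Nat.pos_of_ne_zero hn⟩
      exact (g i).nonempty.resolve_left hN (Finset.sum_eq_zero_iff.1 h i (Finset.mem_univ i))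
  independent := by
    have key : ∀ q q' : (Σ i, Fin (m i)), q ≠ q' → ∀ (e : (b q.1 q.2).tree.E)
        (e' : (b q'.1 q'.2).tree.E),
        ¬ Tree.edge ((g q.1).map q.2 ≫ f.map q.1) e ≤
          Tree.edge ((g q'.1).map q'.2 ≫ f.map q'.1) e' := by
      rintro ⟨i, j⟩ ⟨i', j'⟩ hq e e' hle
      by_cases hi : i = i'
      · subst hi
        have hj : j ≠ j' := fun h => hq (by rw [h])
        obtain ⟨x⟩ := (g i).wide
        have hx := Tree.isOp_map (f.map i) x.down
        have h1 := Tree.edge_mono (f.map i) (Tree.edge_mono ((g i).map j)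
          ((b i j).tree.le_root e))
        have h2 := Tree.edge_mono (f.map i) (Tree.edge_mono ((g i).map j')
          ((b i j').tree.le_root e'))
        exact hj (hx.1 (hx.2.eq_of_le _ ⟨j, rfl⟩ _ ⟨j', rfl⟩ _ h1 (le_trans hle h2)))
      · exact (f.independent i i' hi _ _).1 hle
    intro p p' hp e e'
    have hq := finSigmaFinEquiv.symm.injective.ne hp
    exact ⟨key _ _ hq e e', key _ _ hq.symm e' e⟩
  wide := by
    obtain ⟨x⟩ := f.wide
    have y : ∀ i, d.tree.operad.Op
        (fun j => Tree.edge (f.map i) (Tree.edge ((g i).map j) (b i j).tree.r))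
        (Tree.edge (f.map i) (c i).tree.r) := fun i => ⟨Tree.isOp_map (f.map i)
          (Classical.choice (g i).wide).down⟩
    exact ⟨d.tree.operad.comp x y⟩
  w p := by
    rw [op_comp, Functor.map_comp, comp_apply, f.w, (g _).w]

theorem castHom_comp_eq {ι : Type} {a : ι → Element X} {R : Tree} (F : ∀ q, (a q).tree ⟶ R)
    {q q' : ι} (hq : q = q') (h : a q = a q') : castHom h ≫ F q' = F q := by
  subst hq; simp

end ElementOp

/-- The operad of elements `Ω/X` of a dendroidal set `X`. -/
def elements (nullary : Prop) (X : DSet.{u}) : Operad.{u, 0} where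
  Ob := Element X
  Op c d := ElementOp nullary c d
  one c := ElementOp.one nullary c
  act σ h f := f.act σ h
  comp f g := f.comp g
  act_refl f := by
    ext i
    simp [ElementOp.act]
  act_trans τ σ hτ hσ f := by
    ext i
    simp [ElementOp.act, ElementOp.castHom]
  one_comp f := by
    ext i
    simp [ElementOp.act, ElementOp.comp, ElementOp.one]
    rfl
  comp_one f := by
    ext i
    simp [ElementOp.act, ElementOp.comp, ElementOp.one]
    rfl
  assoc {n m l c d b a} f g h := by
    ext p
    refine Eq.trans ?_ (ElementOp.castHom_comp_eq (ι := Σ i, Σ j, Fin (l i j))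
      (a := fun q => a q.1 q.2.1 q.2.2)
      (fun q => ((h q.1 q.2.1).map q.2.2 ≫ (g q.1).map q.2.1) ≫ f.map q.1)
      (assocEquiv_spec m l p).symm _).symm
    exact (Category.assoc _ _ _).symm
  act_comp {n n' m c d b} σ f g := by
    ext p
    refine Eq.trans ?_ (ElementOp.castHom_comp_eq (ι := Σ i, Fin (m i))
      (a := fun q => b q.1 q.2) (fun q => (g q.1).map q.2 ≫ f.map q.1)
      (blockEquiv_spec m σ p).symm _).symm
    simp [ElementOp.act, ElementOp.comp]
  comp_act {n m m' c d b} τ f g := by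
    ext p
    refine Eq.trans ?_ (ElementOp.castHom_comp_eq (ι := Σ i, Fin (m i))
      (a := fun q => b q.1 q.2) (fun q => (g q.1).map q.2 ≫ f.map q.1)
      (sumEquiv_spec τ p).symm _).symm
    simp [ElementOp.act, ElementOp.comp]

theorem elt_map {X Y : DSet.{u}} (φ : X ⟶ Y) {S R : Tree} (f : S ⟶ R) (β : X.obj (op R)) :
    Y.map f.op (φ.app _ β) = φ.app _ (X.map f.op β) :=
  (NatTrans.naturality_apply φ f.op β).symm

/-- The functor `X ↦ Ω/X`; a map `φ : X ⟶ Y` sends `(T, α)` to `(T, φ ∘ α)` and leaves the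
underlying maps of forests unchanged. -/
def elementsFunctor (nullary : Prop) : DSet.{u} ⥤ Operad.{u, 0} where
  obj X := elements nullary X
  map φ :=
    { ob := fun c => ⟨c.tree, φ.app _ c.elt⟩
      op := fun f =>
        { map := f.map
          nonempty := f.nonempty
          independent := f.independent
          wide := f.wide
          w := fun i => (elt_map φ (f.map i) _).trans (congrArg _ (f.w i)) }
      map_one := fun _ => rfl
      map_act := fun _ _ _ => rfl
      map_comp := fun _ _ => rfl }
  map_id _ := rfl
  map_comp _ _ := rfl

/-- The endofunctor `X ↦ N_d(Ω/X)` of the category of dendroidal sets. -/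
def nerveElements (nullary : Prop) : DSet.{u} ⥤ DSet.{u} :=
  elementsFunctor.{u} nullary ⋙ nerve.{u, 0}

end Dendroidal

/-!
A morphism of operads `F : Ω(T) → Ω/X` has an underlying diagram of trees indexed by the edges of
`T`. If `x ≤ e` are edges of `T`, then the morphism `F(x) ⟶ F(e)` which `F` assigns to an operation
of `Ω(T)` with output `e` and an input `x` does not depend on the operation: expanding all the
inputs other than `x` as far as possible always leads to the same operation. So `F` is determined
by its image over the terminal dendroidal set and by the element of `X` at the root, which is
arbitrary. At each tree, `N_d(Ω/X)` is therefore a coproduct of evaluations of `X`, which gives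
cocontinuity, the Kan extension property, and the preservation of monomorphisms.

The automorphism groups act freely on all of `N_d(Ω/X)`: if `F` is invariant under `σ`, then the
roots of `F(x)` and `F(σ x)` have the same image in the tree at the root of `T`, so independence
makes `x` and `σ x` comparable, and a monotone injection of a finite poset fixes every point that
is comparable with its image.
-/

namespace Dendroidal

theorem map_eq_self_of_comparable {α : Type*} [PartialOrder α] [Finite α] {f : α → α}
    (hf : Monotone f) (hinj : Function.Injective f) {x : α} (hx : x ≤ f x ∨ f x ≤ x) :
    f x = x := by
  obtain ⟨n, hn, hper⟩ := Function.mem_periodicPts.1 (hinj.mem_periodicPts x)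
  rcases hx with hx | hx
  · exact (((hf.monotone_iterate_of_le_map hx) hn).trans_eq hper).antisymm hx
  · exact hx.antisymm (hper.symm.trans_le ((hf.antitone_iterate_of_map_le hx) hn))

/-! ### Cuts of a tree -/

namespace Tree

variable {T : Tree}

theorem le_r (T : Tree) (e : T.E) : e ≤ T.r := T.le_root e

/-- A cut of a tree: a set of pairwise incomparable edges which every path from a leaf to the
root meets. Paths that start at a stump may avoid it. -/
structure IsCut (P : Set T.E) : Prop where
  isAntichain : IsAntichain (· ≤ ·) P
  exists_ge_of_mem_leaves : ∀ l ∈ T.L, ∃ p ∈ P, l ≤ p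

theorem IsCut.isSubtree {P : Set T.E} (hP : IsCut P) (e : T.E) (he : ∀ p ∈ P, ¬ e < p) :
    T.IsSubtree (P ∩ Set.Iic e) e := by
  induction e using WellFoundedLT.induction with
  | ind e ih =>
  by_cases heP : e ∈ P
  · have hsingle : P ∩ Set.Iic e = {e} :=
      Set.eq_singleton_iff_unique_mem.2
        ⟨⟨heP, Set.self_mem_Iic⟩, fun x hx => hP.isAntichain.eq hx.1 heP hx.2⟩
    exact hsingle ▸ IsSubtree.edge e
  · have he_le : ∀ p ∈ P, ¬ e ≤ p := fun p hp hle =>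
      he p hp (hle.lt_of_ne fun h => heP (h ▸ hp))
    have hleaf : e ∉ T.L := fun hl =>
      let ⟨p, hp, hle⟩ := hP.exists_ge_of_mem_leaves e hl
      he_le p hp hle
    have hsplit : P ∩ Set.Iic e = {x | ∃ i, i ⋖ e ∧ x ∈ P ∩ Set.Iic i} := by
      ext x
      constructor
      · rintro ⟨hx, hxe⟩
        obtain ⟨i, hxi, hi⟩ := exists_le_covBy_of_lt
          ((show x ≤ e from hxe).lt_of_ne fun h => heP (h ▸ hx))
        exact ⟨i, hi, hx, hxi⟩
      · rintro ⟨i, hi, hx, hxi⟩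
        exact ⟨hx, (show x ≤ i from hxi).trans hi.le⟩
    rw [hsplit]
    refine IsSubtree.graft e hleaf _ fun i hi => ih i hi.lt fun p hp hip => ?_
    rcases T.le_total_above i e p hi.le hip.le with hep | hpe
    · exact he_le p hp hep
    · exact hi.2 hip ((show p ≤ e from hpe).lt_of_ne fun h => heP (h ▸ hp))

/-- The cut consisting of a given set `B` of incomparable edges and of the leaves that are not
below any edge of `B`. -/
def cutThrough (B : Set T.E) : Set T.E := B ∪ {l | l ∈ T.L ∧ ∀ b ∈ B, ¬ l ≤ b}

theorem isCut_cutThrough {B : Set T.E} (hB : IsAntichain (· ≤ ·) B) : IsCut (cutThrough B) where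
  isAntichain := by
    rintro x (hx | ⟨-, hxB⟩) y (hy | ⟨hy, -⟩) hne hle
    · exact hB hx hy hne hle
    · exact hne (T.leaves_minimal y hy x hle)
    · exact hxB y hy hle
    · exact hne (T.leaves_minimal y hy x hle)
  exists_ge_of_mem_leaves l hl := by
    by_cases h : ∃ b ∈ B, l ≤ b
    · obtain ⟨b, hb, hle⟩ := h
      exact ⟨b, Or.inl hb, hle⟩
    · push Not at h
      exact ⟨l, Or.inr ⟨hl, h⟩, le_rfl⟩

theorem isSubtree_cutThrough {B : Set T.E} (hB : IsAntichain (· ≤ ·) B) {e : T.E}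
    (he : ∀ b ∈ B, ¬ e < b) : T.IsSubtree (cutThrough B ∩ Set.Iic e) e := by
  refine (isCut_cutThrough hB).isSubtree e ?_
  rintro p (hp | ⟨hp, -⟩) hlt
  · exact he p hp hlt
  · exact hlt.ne (T.leaves_minimal p hp e hlt.le)

theorem IsSubtree.exists_isOp {A : Set T.E} {e : T.E} (h : T.IsSubtree A e) :
    ∃ (n : ℕ) (c : Fin n → T.E), T.IsOp c e ∧ Set.range c = A := by
  obtain ⟨n, c, hc, rfl⟩ := A.toFinite.fin_param
  exact ⟨n, c, ⟨hc, h⟩, rfl⟩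

theorem exists_isOp_subset_range {B : Set T.E} (hB : IsAntichain (· ≤ ·) B) {e : T.E}
    (he : ∀ b ∈ B, b ≤ e) :
    ∃ (n : ℕ) (c : Fin n → T.E), T.IsOp c e ∧ B ⊆ Set.range c := by
  obtain ⟨n, c, hc, hr⟩ :=
    (isSubtree_cutThrough hB fun b hb hlt => (he b hb).not_gt hlt).exists_isOp
  exact ⟨n, c, hc, hr ▸ fun b hb => ⟨Or.inl hb, he b hb⟩⟩

theorem IsSubtree.exists_ge_of_mem_leaves {A : Set T.E} {e : T.E} (h : T.IsSubtree A e) :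
    ∀ l ∈ T.L, l ≤ e → ∃ a ∈ A, l ≤ a := by
  induction h with
  | edge e => exact fun l _ hle => ⟨e, rfl, hle⟩
  | graft e he A _ ih =>
    intro l hl hle
    obtain ⟨i, hli, hi⟩ := exists_le_covBy_of_lt (hle.lt_of_ne fun h => he (h ▸ hl))
    obtain ⟨a, ha, hla⟩ := ih i hi l hl hli
    exact ⟨a, ⟨i, hi, ha⟩, hla⟩

variable {n : ℕ} {c : Fin n → T.E} {e : T.E}

theorem IsOp.exists_equiv_of_range_eq {m : ℕ} {c' : Fin m → T.E} (hc : T.IsOp c e)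
    (hc' : T.IsOp c' e) (h : Set.range c = Set.range c') :
    ∃ σ : Fin n ≃ Fin m, ∀ i, c i = c' (σ i) :=
  ⟨(Equiv.ofInjective c hc.1).trans
      ((Equiv.setCongr h).trans (Equiv.ofInjective c' hc'.1).symm), fun i =>
    (congrArg Subtype.val ((Equiv.ofInjective c' hc'.1).apply_symm_apply
      (Equiv.setCongr h (Equiv.ofInjective c hc.1 i)))).symm⟩

theorem IsOp.exists_refinement (hc : T.IsOp c e) (i : Fin n) {x : T.E} (hx : x ≤ c i) :
    ∃ (m : Fin n → ℕ) (b : ∀ j, Fin (m j) → T.E) (k : Fin (m i)), (∀ j, T.IsOp (b j) (c j)) ∧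
      (∀ j, Set.range (b j) = cutThrough {x} ∩ Set.Iic (c j)) ∧ b i k = x := by
  have hbelow : ∀ j, ∀ y ∈ ({x} : Set T.E), ¬ c j < y := by
    rintro j _ rfl hlt
    have hji := hc.2.eq_of_le _ ⟨j, rfl⟩ _ ⟨i, rfl⟩ _ le_rfl (hlt.le.trans hx)
    exact (hji ▸ hlt).not_ge hx
  choose m b hb hbr using fun j =>
    (isSubtree_cutThrough IsAntichain.singleton (hbelow j)).exists_isOp
  obtain ⟨k, hk⟩ : x ∈ Set.range (b i) := hbr i ▸ ⟨Or.inl rfl, hx⟩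
  exact ⟨m, b, k, hb, hbr, hk⟩

theorem IsOp.range_refinement (hc : T.IsOp c e) (i : Fin n) {x : T.E} (hx : x ≤ c i)
    {m : Fin n → ℕ} {b : ∀ j, Fin (m j) → T.E}
    (hb : ∀ j, Set.range (b j) = cutThrough {x} ∩ Set.Iic (c j)) :
    Set.range (fun p : Fin (∑ j, m j) =>
      b (finSigmaFinEquiv.symm p).1 (finSigmaFinEquiv.symm p).2) =
        cutThrough {x} ∩ Set.Iic e := by
  have hunion : Set.range (fun p : Fin (∑ j, m j) =>
      b (finSigmaFinEquiv.symm p).1 (finSigmaFinEquiv.symm p).2) = ⋃ j, Set.range (b j) :=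
    (finSigmaFinEquiv.symm.surjective.range_comp
      fun q : (Σ j, Fin (m j)) => b q.1 q.2).trans (Set.range_sigma_eq_iUnion_range _)
  rw [hunion]
  simp only [hb, ← Set.inter_iUnion]
  refine Set.Subset.antisymm (Set.inter_subset_inter_right _ (Set.iUnion_subset fun j =>
    Set.Iic_subset_Iic.2 (hc.2.le _ ⟨j, rfl⟩))) ?_
  rintro y ⟨rfl | hy, hye⟩
  · exact ⟨Or.inl rfl, Set.mem_iUnion.2 ⟨i, hx⟩⟩
  · obtain ⟨_, ⟨j, rfl⟩, hyj⟩ := hc.2.exists_ge_of_mem_leaves y hy.1 hye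
    exact ⟨Or.inr hy, Set.mem_iUnion.2 ⟨j, hyj⟩⟩

theorem exists_isOp_range_eq_cutThrough {x : T.E} (hx : x ≤ e) :
    ∃ (n : ℕ) (c : Fin n → T.E) (i : Fin n), T.IsOp c e ∧ c i = x ∧
      Set.range c = cutThrough {x} ∩ Set.Iic e := by
  obtain ⟨n, c, hc, hr⟩ := (isSubtree_cutThrough (B := {x}) IsAntichain.singleton
    (by rintro _ rfl; exact hx.not_gt)).exists_isOp
  obtain ⟨i, hi⟩ : x ∈ Set.range c := hr ▸ ⟨Or.inl rfl, hx⟩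
  exact ⟨n, c, i, hc, hi, hr⟩

theorem hom_ext {S : Tree} {f g : S ⟶ T} (h : ∀ e, edge f e = edge g e) : f = g := by
  obtain ⟨fo, fp, _, _, _⟩ := f
  obtain ⟨go, gp, _, _, _⟩ := g
  obtain rfl : fo = go := funext h
  obtain rfl : @fp = @gp := by
    funext n c d x
    exact PLift.down_injective rfl
  rfl

theorem edge_injective {S : Tree} (σ : S ≅ T) : Function.Injective (edge σ.hom) :=
  Function.LeftInverse.injective (g := edge σ.inv) fun e => by
    rw [← edge_comp, σ.hom_inv_id]; rfl

theorem edge_root {S : Tree} (σ : S ≅ T) : edge σ.hom S.r = T.r := by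
  refine _root_.le_antisymm (T.le_r _) ?_
  calc T.r = edge σ.hom (edge σ.inv T.r) := by rw [← edge_comp, σ.inv_hom_id]; rfl
    _ ≤ edge σ.hom S.r := edge_mono σ.hom (S.le_r _)

end Tree

/-! ### The cocartesian operad of a category -/

theorem eqToHom_comp_apply {C ι : Type*} [Category C] {a : ι → C} {d : C} (F : ∀ q, a q ⟶ d)
    {q q' : ι} (hq : q = q') (h : a q = a q') : eqToHom h ≫ F q' = F q := by
  subst hq
  simp

/-- The operad `C_⊔` of a category `C`: an operation `(c₁, …, cₙ) → d` is a family of morphisms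
`cᵢ ⟶ d`. The operad of elements lives over that of the category of trees. -/
def cocartesianOperad (C : Type u) [Category.{v} C] : Operad.{u, v} where
  Ob := C
  Op c d := ∀ i, c i ⟶ d
  one c _ := 𝟙 c
  act σ h f i := eqToHom (h i) ≫ f (σ i)
  comp f g p := g (finSigmaFinEquiv.symm p).1 (finSigmaFinEquiv.symm p).2 ≫
    f (finSigmaFinEquiv.symm p).1
  act_refl f := by
    ext i
    simp
  act_trans τ σ hτ hσ f := by
    ext i
    simp
  one_comp f := by
    ext p
    exact (Category.comp_id _).trans (Category.id_comp _).symm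
  comp_one f := by
    ext p
    rfl
  assoc {n m l c d b a} f g h := by
    ext p
    refine Eq.trans ?_ (eqToHom_comp_apply (ι := Σ i, Σ j, Fin (l i j))
      (fun q => (h q.1 q.2.1 q.2.2 ≫ g q.1 q.2.1) ≫ f q.1) (assocEquiv_spec m l p).symm _).symm
    exact (Category.assoc _ _ _).symm
  act_comp {n n' m c d b} σ f g := by
    ext p
    refine Eq.trans ?_ (eqToHom_comp_apply (ι := Σ i, Fin (m i))
      (fun q => g q.1 q.2 ≫ f q.1) (blockEquiv_spec m σ p).symm _).symm
    simp
  comp_act {n m m' c d b} τ f g := by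
    ext p
    refine Eq.trans ?_ (eqToHom_comp_apply (ι := Σ i, Fin (m i))
      (fun q => g q.1 q.2 ≫ f q.1) (sumEquiv_spec τ p).symm _).symm
    simp

/-- A diagram of shape `T` in a category `C`: a morphism of operads `Ω(T) → C_⊔`. It amounts to a
functor from the poset of edges of `T` to `C`, whose value on `x ≤ e` is `edgeMap`. -/
abbrev TreeDiagram (T : Tree) (C : Type u) [Category.{v} C] :=
  Operad.Hom T.operad (cocartesianOperad C)

namespace TreeDiagram

variable {T : Tree} {C : Type u} [Category.{v} C] (F : TreeDiagram T C)

/-- The object of `C` that a diagram of shape `T` assigns to an edge of `T`. -/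
def label (e : T.E) : C := F.ob e

variable {m n : ℕ} {c : Fin n → T.E} {c' : Fin m → T.E} {e : T.E}

/-- The components of the operation of `C_⊔` that a diagram of shape `T` assigns to an operation
of `Ω(T)`. -/
def component (hc : T.IsOp c e) (i : Fin n) : F.label (c i) ⟶ F.label e :=
  F.op (c := c) (d := e) ⟨hc⟩ i

theorem component_one (e : T.E) (i : Fin 1) :
    F.component (Tree.IsOp.one T e) i = 𝟙 (F.label e) :=
  congrFun (F.map_one e) i

theorem component_act (σ : Fin m ≃ Fin n) (h : ∀ i, c' i = c (σ i)) (hc : T.IsOp c e)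
    (i : Fin m) : F.component (hc.act σ h) i =
      eqToHom (congrArg F.label (h i)) ≫ F.component hc (σ i) :=
  congrFun (F.map_act σ h ⟨hc⟩) i

theorem component_comp {m : Fin n → ℕ} {b : ∀ i, Fin (m i) → T.E} (hc : T.IsOp c e)
    (hb : ∀ i, T.IsOp (b i) (c i)) {p : Fin (∑ i, m i)} {i : Fin n} {k : Fin (m i)}
    (hp : finSigmaFinEquiv.symm p = ⟨i, k⟩) : F.component (hc.comp hb) p =
      eqToHom (congrArg (fun q : (Σ i, Fin (m i)) => F.label (b q.1 q.2)) hp) ≫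
        F.component (hb i) k ≫ F.component hc i :=
  (congrFun (F.map_comp (c := c) (d := e) ⟨hc⟩ fun i => ⟨hb i⟩) p).trans
    (eqToHom_comp_apply (ι := Σ i, Fin (m i))
      (fun q => F.component (hb q.1) q.2 ≫ F.component hc q.1) hp _).symm

theorem component_eq_of_range_eq (hc : T.IsOp c e) (hc' : T.IsOp c' e)
    (hr : Set.range c = Set.range c') {i : Fin n} {j : Fin m} (h : c i = c' j) :
    F.component hc i = eqToHom (congrArg F.label h) ≫ F.component hc' j := by
  obtain ⟨σ, hσ⟩ := hc.exists_equiv_of_range_eq hc' hr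
  obtain rfl : σ i = j := hc'.1 ((hσ i).symm.trans h)
  exact F.component_act σ hσ hc' i

theorem component_eq_eqToHom (hc : T.IsOp c e) {i : Fin n} (h : c i = e) :
    F.component hc i = eqToHom (congrArg F.label h) := by
  have hr : Set.range c = Set.range fun _ : Fin 1 => e := by
    ext x
    constructor
    · rintro ⟨j, rfl⟩
      exact ⟨0, (hc.2.eq_of_le _ ⟨j, rfl⟩ _ ⟨i, rfl⟩ _ le_rfl
        ((hc.2.le _ ⟨j, rfl⟩).trans_eq h.symm)).symm ▸ h.symm⟩
    · rintro ⟨-, rfl⟩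
      exact ⟨i, h⟩
  rw [F.component_eq_of_range_eq hc (Tree.IsOp.one T e) hr (j := 0) h, component_one]
  exact Category.comp_id _

/-- The morphism between the objects assigned to two edges `x ≤ e` of `T`. It is read off from the
largest subtree with root `e` that has `x` among its leaves. -/
noncomputable def edgeMap {x e : T.E} (h : x ≤ e) : F.label x ⟶ F.label e :=
  let op := (Tree.exists_isOp_range_eq_cutThrough h).choose_spec.choose_spec
  eqToHom (congrArg F.label op.choose_spec.2.1.symm) ≫
    F.component op.choose_spec.1 op.choose

theorem component_eq_edgeMap_of_range_eq (hc : T.IsOp c e) {i : Fin n} {x : T.E} (hi : c i = x)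
    (hx : x ≤ e) (hr : Set.range c = Tree.cutThrough {x} ∩ Set.Iic e) :
    F.component hc i = eqToHom (congrArg F.label hi) ≫ F.edgeMap hx := by
  have op := (Tree.exists_isOp_range_eq_cutThrough hx).choose_spec.choose_spec.choose_spec
  rw [edgeMap, F.component_eq_of_range_eq hc op.1 (hr.trans op.2.2.symm) (hi.trans op.2.1.symm),
    eqToHom_trans_assoc]

theorem edgeMap_refl (e : T.E) : F.edgeMap (le_refl e) = 𝟙 (F.label e) := by
  obtain ⟨n, c, i, hc, hi, hr⟩ := Tree.exists_isOp_range_eq_cutThrough (le_refl e)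
  have h := F.component_eq_edgeMap_of_range_eq hc hi le_rfl hr
  rw [F.component_eq_eqToHom hc hi] at h
  exact (cancel_epi (eqToHom (congrArg F.label hi))).1 (h.symm.trans (Category.comp_id _).symm)

theorem edgeMap_comp_component (hc : T.IsOp c e) (i : Fin n) {x : T.E} (hx : x ≤ c i) :
    F.edgeMap hx ≫ F.component hc i = F.edgeMap (hx.trans (hc.2.le _ ⟨i, rfl⟩)) := by
  obtain ⟨m, b, k, hb, hbr, rfl⟩ := hc.exists_refinement i hx
  have hp := finSigmaFinEquiv.symm_apply_apply (⟨i, k⟩ : Σ i, Fin (m i))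
  have h := F.component_comp hc hb hp
  rw [F.component_eq_edgeMap_of_range_eq (hb i) rfl hx (hbr i),
    F.component_eq_edgeMap_of_range_eq (hc.comp hb)
      (congrArg (fun q : (Σ i, Fin (m i)) => b q.1 q.2) hp) (hx.trans (hc.2.le _ ⟨i, rfl⟩))
      (hc.range_refinement i hx hbr), eqToHom_refl, Category.id_comp] at h
  exact ((cancel_epi _).1 h).symm

theorem component_eq_edgeMap (hc : T.IsOp c e) (i : Fin n) :
    F.component hc i = F.edgeMap (hc.2.le _ ⟨i, rfl⟩) := by
  rw [← F.edgeMap_comp_component hc i le_rfl, edgeMap_refl, Category.id_comp]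

theorem edgeMap_trans {x y e : T.E} (hxy : x ≤ y) (hye : y ≤ e) :
    F.edgeMap hxy ≫ F.edgeMap hye = F.edgeMap (hxy.trans hye) := by
  obtain ⟨n, c, i, hc, rfl, -⟩ := Tree.exists_isOp_range_eq_cutThrough hye
  rw [← F.component_eq_edgeMap hc i, edgeMap_comp_component]

/-- The restriction of a diagram along a morphism of trees. -/
def restrict {S : Tree} (φ : S ⟶ T) : TreeDiagram S C := Operad.Hom.comp φ F

theorem edgeMap_restrict {S : Tree} (φ : S ⟶ T) {x e : S.E} (h : x ≤ e) :
    (F.restrict φ).edgeMap h = F.edgeMap (Tree.edge_mono φ h) := by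
  obtain ⟨n, c, i, hc, rfl, -⟩ := Tree.exists_isOp_range_eq_cutThrough h
  rw [← component_eq_edgeMap _ hc i]
  exact F.component_eq_edgeMap (Tree.isOp_map φ hc) i

end TreeDiagram

/-! ### Trees in the operad of elements -/

section

variable (N : Prop) (X : DSet.{u})

/-- The morphism from the operad of elements of `X` to the cocartesian operad of the category of
trees which remembers only the trees and the morphisms between them. -/
def elementsForget : Operad.Hom (elements N X) (cocartesianOperad Tree) where
  ob := Element.tree
  op f := ElementOp.map f
  map_one _ := rfl
  map_act _ _ _ := rfl
  map_comp _ _ := rfl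

end

section

variable {N : Prop} {X : DSet.{u}} {T : Tree}

/-- The diagram of trees underlying a morphism `Ω(T) → Ω/X`. -/
def treeDiagram (F : Operad.Hom T.operad (elements N X)) : TreeDiagram T Tree :=
  F.comp (elementsForget N X)

theorem map_op_eq_edgeMap (F : Operad.Hom T.operad (elements N X)) {n : ℕ} {c : Fin n → T.E}
    {e : T.E} (f : T.operad.Op c e) (i : Fin n) :
    ElementOp.map (F.op f) i = (treeDiagram F).edgeMap (f.down.2.le _ ⟨i, rfl⟩) :=
  (treeDiagram F).component_eq_edgeMap f.down i

theorem map_edgeMap_elt (F : Operad.Hom T.operad (elements N X)) {x e : T.E} (h : x ≤ e) :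
    X.map ((treeDiagram F).edgeMap h).op (F.ob e).elt = (F.ob x).elt := by
  obtain ⟨n, c, i, hc, rfl, -⟩ := Tree.exists_isOp_range_eq_cutThrough h
  exact map_op_eq_edgeMap F (c := c) ⟨hc⟩ i ▸ ElementOp.w (F.op (c := c) (d := e) ⟨hc⟩) i

theorem TreeDiagram.map_edgeMap_refl (D : TreeDiagram T Tree) {e : T.E}
    (a : X.obj (op (D.label e))) : X.map (D.edgeMap (le_refl e)).op a = a := by
  rw [edgeMap_refl, op_id, Functor.map_id_apply]

theorem TreeDiagram.map_edgeMap_map_edgeMap (D : TreeDiagram T Tree) {x y e : T.E} (hxy : x ≤ y)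
    (hye : y ≤ e) (a : X.obj (op (D.label e))) :
    X.map (D.edgeMap hxy).op (X.map (D.edgeMap hye).op a) =
      X.map (D.edgeMap (hxy.trans hye)).op a := by
  rw [← D.edgeMap_trans hxy hye, op_comp, Functor.map_comp_apply]

/-- The terminal dendroidal set. -/
def terminalDSet : DSet.{u} := (Functor.const _).obj PUnit

/-- The morphism from a dendroidal set to the terminal one. -/
def toTerminal (X : DSet.{u}) : X ⟶ terminalDSet where
  app _ := ↾fun _ => PUnit.unit

/-- The morphism to the operad of elements of the terminal dendroidal set which forgets the
elements of `X`. -/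
def shape {P : Operad.{u', v'}} (F : Operad.Hom P (elements N X)) :
    Operad.Hom P (elements.{u} N terminalDSet) :=
  F.comp ((elementsFunctor N).map (toTerminal X))

/-- The lift of a morphism to the operad of elements of the terminal dendroidal set along a
compatible choice `s` of elements of `X`. -/
def liftHom {P : Operad.{u', v'}} (F : Operad.Hom P (elements.{u} N terminalDSet))
    (s : ∀ c, X.obj (op (F.ob c).tree))
    (hs : ∀ {n : ℕ} {c : Fin n → P.Ob} {d : P.Ob} (f : P.Op c d) (i : Fin n),
      X.map (ElementOp.map (F.op f) i).op (s d) = s (c i)) :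
    Operad.Hom P (elements N X) where
  ob c := ⟨(F.ob c).tree, s c⟩
  op f :=
    { map := fun i => ElementOp.map (F.op f) i
      nonempty := ElementOp.nonempty (F.op f)
      independent := ElementOp.independent (F.op f)
      wide := ElementOp.wide (F.op f)
      w := hs f }
  map_one c := ElementOp.ext (congrArg (fun k => ElementOp.map k) (F.map_one c) :)
  map_act σ h f := ElementOp.ext (congrArg (fun k => ElementOp.map k) (F.map_act σ h f) :)
  map_comp f g := ElementOp.ext (congrArg (fun k => ElementOp.map k) (F.map_comp f g) :)

theorem liftHom_shape {P : Operad.{u', v'}} (F : Operad.Hom P (elements N X))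
    {s : ∀ c, X.obj (op (F.ob c).tree)} (hs) (h : ∀ c, s c = (F.ob c).elt) :
    liftHom (shape F) s hs = F := by
  obtain rfl : s = fun c => (F.ob c).elt := funext h
  rfl

/-- A morphism `Ω(T) → Ω/X` is determined by its diagram of trees and by the element of `X` at
the root of `T`, and this element is arbitrary. -/
noncomputable def homElementsEquiv (N : Prop) (T : Tree) (X : DSet.{u}) :
    Operad.Hom T.operad (elements N X) ≃
    Σ F : Operad.Hom T.operad (elements.{u} N terminalDSet), X.obj (op (F.ob T.r).tree) where
  toFun F := ⟨shape F, (F.ob T.r).elt⟩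
  invFun p := liftHom p.1 (fun e => X.map ((treeDiagram p.1).edgeMap (T.le_r e)).op p.2)
    fun f i => by
      refine (congrArg (fun g : _ ⟶ _ => X.map g.op _) (map_op_eq_edgeMap p.1 f i)).trans ?_
      exact (treeDiagram p.1).map_edgeMap_map_edgeMap (f.down.2.le _ ⟨i, rfl⟩) (T.le_r _) p.2
  left_inv F := liftHom_shape F _ fun e => map_edgeMap_elt F (T.le_r e)
  right_inv p := Sigma.ext rfl (heq_of_eq ((treeDiagram p.1).map_edgeMap_refl p.2))
end

/-! ### Cocontinuity -/

section

variable {C : Type u'} [Category.{v'} C] {I : Type u} (R : I → C)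

/-- A sum of values of a functor to the category of types, as the colimit of its restriction to a
discrete category. -/
noncomputable def sigmaIsoColimit (X : C ⥤ Type u) :
    (Σ i, X.obj (R i)) ≅ colimit (Discrete.functor R ⋙ X) :=
  (Types.coproductIso.{u} _).symm ≪≫ HasColimit.isoOfNatIso (Discrete.compNatIsoDiscrete R X).symm

theorem sigmaIsoColimit_hom_apply (X : C ⥤ Type u) (i : I) (x : X.obj (R i)) :
    (sigmaIsoColimit R X).hom ⟨i, x⟩ = colimit.ι (Discrete.functor R ⋙ X) ⟨i⟩ x :=
  ConcreteCategory.congr_hom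
    (HasColimit.isoOfNatIso_ι_hom (Discrete.compNatIsoDiscrete R X).symm ⟨i⟩) x

theorem sigmaIsoColimit_naturality {X Y : C ⥤ Type u} (φ : X ⟶ Y) (p : Σ i, X.obj (R i)) :
    (sigmaIsoColimit R Y).hom ⟨p.1, φ.app _ p.2⟩ =
      colimMap (Functor.whiskerLeft (Discrete.functor R) φ) ((sigmaIsoColimit R X).hom p) := by
  rw [sigmaIsoColimit_hom_apply, sigmaIsoColimit_hom_apply]
  exact (ConcreteCategory.congr_hom (ι_colimMap (Functor.whiskerLeft (Discrete.functor R) φ)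
    ⟨p.1⟩) p.2).symm

end

/-- Evaluating `N_d(Ω/X)` at a tree gives a coproduct of evaluations of `X`, one for each morphism
from `Ω(T)` to the operad of elements of the terminal dendroidal set. -/
noncomputable def nerveElementsEvaluationIso (N : Prop) (T : Tree) :
    nerveElements.{u} N ⋙ (evaluation _ _).obj (op T) ≅
      (Functor.whiskeringLeft _ _ _).obj (Discrete.functor
        fun F : Operad.Hom T.operad (elements N terminalDSet.{u}) => op (F.ob T.r).tree) ⋙ colim :=
  NatIso.ofComponents (fun X => (homElementsEquiv N T X).toIso ≪≫ sigmaIsoColimit _ X) fun φ => by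
    ext F
    exact sigmaIsoColimit_naturality _ φ (homElementsEquiv N T _ F)

instance (N : Prop) : PreservesColimitsOfSize.{u, u} (nerveElements.{u} N) :=
  preservesColimits_of_evaluation _ fun T =>
    preservesColimits_of_natIso (nerveElementsEvaluationIso N T.unop).symm

/-! ### Monomorphisms and automorphisms -/

theorem nerveElements_map_app_injective {N : Prop} {X Y : DSet.{u}} (f : X ⟶ Y) [Mono f]
    (T : Tree) : Function.Injective (((nerveElements.{u} N).map f).app (op T)) := by
  have h : Function.Injective (Sigma.map (β₂ := fun F => Y.obj (op (F.ob T.r).tree)) id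
      fun (F : Operad.Hom T.operad (elements N terminalDSet))
        (a : X.obj (op (F.ob T.r).tree)) => f.app _ a) :=
    Function.injective_id.sigma_map fun F => (mono_iff_injective (f.app _)).1 inferInstance
  exact Function.Injective.of_comp (f := homElementsEquiv N T Y)
    (h.comp (homElementsEquiv N T X).injective)

section

variable {N : Prop} {X : DSet.{u}} {S T : Tree}

/-- For edges `x ≤ e` of `T` and a morphism `F : Ω(T) → Ω/X`, the edge of the tree `F(e)` which
is the image of the root of the tree `F(x)`. It is paired with the tree `F(e)`, so that the images
for different `F` and `e` can be compared. -/
noncomputable def rootImage (F : Operad.Hom T.operad (elements N X)) {x e : T.E} (h : x ≤ e) :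
    Σ R : Tree, R.E :=
  ⟨(F.ob e).tree, Tree.edge ((treeDiagram F).edgeMap h) (F.ob x).tree.r⟩

theorem rootImage_eq_of_isOp (F : Operad.Hom T.operad (elements N X)) {n : ℕ} {c : Fin n → T.E}
    {e : T.E} (hc : T.IsOp c e) (i : Fin n) : rootImage F (hc.2.le _ ⟨i, rfl⟩) =
      ⟨(F.ob e).tree, Tree.edge (ElementOp.map (F.op (c := c) (d := e) ⟨hc⟩) i)
        (F.ob (c i)).tree.r⟩ :=
  congrArg (fun g => (⟨(F.ob e).tree, Tree.edge g (F.ob (c i)).tree.r⟩ : Σ R : Tree, R.E))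
    (map_op_eq_edgeMap F (c := c) ⟨hc⟩ i).symm

theorem rootImage_comp (F : Operad.Hom T.operad (elements N X)) (φ : S ⟶ T) {x e : S.E}
    (h : x ≤ e) : rootImage (Operad.Hom.comp φ F) h = rootImage F (Tree.edge_mono φ h) :=
  congrArg (fun g => (⟨(F.ob (Tree.edge φ e)).tree, Tree.edge g (F.ob (Tree.edge φ x)).tree.r⟩ :
    Σ R : Tree, R.E)) ((treeDiagram F).edgeMap_restrict φ h)

theorem rootImage_ne (F : Operad.Hom T.operad (elements N X)) {x y e : T.E} (hx : x ≤ e)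
    (hy : y ≤ e) (hxy : ¬ x ≤ y) (hyx : ¬ y ≤ x) : rootImage F hx ≠ rootImage F hy := by
  have hB : IsAntichain (· ≤ ·) {x, y} := by
    rintro a (rfl | rfl) b (rfl | rfl) hab
    exacts [(hab rfl).elim, hxy, hyx, (hab rfl).elim]
  obtain ⟨n, c, hc, hr⟩ := Tree.exists_isOp_subset_range hB (e := e)
    (by rintro a (rfl | rfl) <;> assumption)
  obtain ⟨i, rfl⟩ := hr (Or.inl rfl)
  obtain ⟨j, rfl⟩ := hr (Or.inr rfl)
  intro h
  have hij : i ≠ j := fun h => hxy (h ▸ le_rfl)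
  have hroots := sigma_mk_injective
    ((rootImage_eq_of_isOp F hc i).symm.trans (h.trans (rootImage_eq_of_isOp F hc j)))
  exact (ElementOp.independent (F.op (c := c) (d := e) ⟨hc⟩) i j hij _ _).1 hroots.le

theorem eq_refl_of_comp_eq (F : Operad.Hom T.operad (elements N X)) (σ : T ≅ T)
    (hσ : Operad.Hom.comp σ.hom F = F) : σ = Iso.refl T := by
  refine Iso.ext (Tree.hom_ext fun e => ?_)
  by_contra hne
  have hroot : rootImage F (T.le_r (Tree.edge σ.hom e)) = rootImage F (T.le_r e) :=
    calc rootImage F (T.le_r (Tree.edge σ.hom e))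
      _ = rootImage F (Tree.edge_mono σ.hom (T.le_r e)) := by simp only [Tree.edge_root]
      _ = rootImage (Operad.Hom.comp σ.hom F) (T.le_r e) := (rootImage_comp F σ.hom _).symm
      _ = rootImage F (T.le_r e) := by rw [hσ]
  have hfix := fun h => map_eq_self_of_comparable (Tree.edge_mono σ.hom) (Tree.edge_injective σ)
    (x := e) h
  exact rootImage_ne F _ _ (hne ∘ hfix ∘ Or.inr) (hne ∘ hfix ∘ Or.inl) hroot

end

theorem isNormalMono_nerveElements_map (N : Prop) {X Y : DSet.{u}} (f : X ⟶ Y) [Mono f] :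
    IsNormalMono ((nerveElements.{u} N).map f) := by
  have hmono (T : Treeᵒᵖ) : Mono (((nerveElements.{u} N).map f).app T) :=
    (mono_iff_injective _).2 (nerveElements_map_app_injective f T.unop)
  exact ⟨NatTrans.mono_of_mono_app _, fun T F _ σ hσ => eq_refl_of_comp_eq F σ hσ⟩

end Dendroidal

theorem mainTheorem8_general (nullary : Prop) :
    PreservesColimitsOfSize.{u, u} (Dendroidal.nerveElements.{u} nullary) ∧
    (Dendroidal.nerveElements.{u} nullary).IsLeftKanExtension
      (𝟙 (uliftYoneda.{u} (C := Dendroidal.Tree) ⋙ Dendroidal.nerveElements.{u} nullary)) ∧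
    ∀ (X Y : Dendroidal.DSet.{u}) (f : X ⟶ Y), Mono f →
      Dendroidal.IsNormalMono ((Dendroidal.nerveElements.{u} nullary).map f) := by
  have : PreservesColimitsOfSize.{0, u} (Dendroidal.nerveElements.{u} nullary) :=
    preservesColimitsOfSize_shrink _
  exact ⟨inferInstance, Presheaf.isLeftKanExtension_of_preservesColimits.{u} _ (Iso.refl _),
    fun _ _ f _ => Dendroidal.isNormalMono_nerveElements_map nullary f⟩

theorem mainTheorem8 (nullary : Prop) :
    PreservesColimitsOfSize.{u, u} (Dendroidal.nerveElements.{u} nullary) ∧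
    (Dendroidal.nerveElements.{u} nullary).IsLeftKanExtension
      (𝟙 (uliftYoneda.{u} (C := Dendroidal.Tree) ⋙ Dendroidal.nerveElements.{u} nullary)) ∧
    ∀ (X Y : Dendroidal.DSet.{u}) (f : X ⟶ Y), Dendroidal.IsNormalMono f →
      Dendroidal.IsNormalMono ((Dendroidal.nerveElements.{u} nullary).map f) :=
  have ⟨hcolim, hkan, hmono⟩ := mainTheorem8_general nullary
  ⟨hcolim, hkan, fun X Y f hf => hmono X Y f hf.1⟩
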